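/- **Setting.** Let $(I,\mathbb A,m)$ be a measure space with $m(I)<\infty$ and write $|Q|=m(Q)$. Let $\mathcal P=(\mathcal P^k)_{k\ge 0}$ be a $(\lambda_1,\lambda_2)$-good grid with $0<\lambda_1<\lambda_2<1$, that is: each $\mathcal P^k$ is a finite family of measurable sets of positive measure, at least one of the families is non-empty, the number of elements of $\mathcal P^k$ that meet a given $Q\in\mathcal P^k$ is bounded uniformly in $k$ and $Q$, and no set belongs to two different levels; $\mathcal P^0=\{I\}$; for every $k$ the elements of $\mathcal P^k$ are pairwise disjoint and cover $I$ up to a null set; every $Q\in\mathcal P^{k+1}$ is contained in some $R\in\mathcal P^k$; $\lambda_1\le |Q|/|R|\le\lambda_2$ whenever $Q\subset R$, $Q\in\mathcal P^{k+1}$, $R\in\mathcal P^k$; and $\bigcup_k\mathcal P^k$ generates the $\sigma$-algebra $\mathbb A$. Let $p\in[1,\infty)$, $q\in[1,\infty]$ and $0<s<1/p$. For $Q\in\bigcup_k\mathcal P^k$, an $(s,p)$-Souza atom on $Q$ is a function $a\colon I\to\mathbb C$ that vanishes off $Q$, is constant on $Q$, and satisfies $|a|_\infty\le|Q|^{s-1/p}$.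 The space $\mathcal B^s_{p,q}$ consists of all complex-valued $f\in L^p(m)$ that have a representation $$f=\sum_{k=0}^\infty\sum_{Q\in\mathcal P^k}c_Qa_Q,\qquad c_Q\in\mathbb C,\quad a_Q \text{ an } (s,p)\text{-Souza atom on } Q,$$ where the series over $k$ converges absolutely in $L^p$ (that is, $\sum_k\big|\sum_{Q\in\mathcal P^k}c_Qa_Q\big|_p<\infty$) and the cost $\big(\sum_k(\sum_{Q\in\mathcal P^k}|c_Q|^p)^{q/p}\big)^{1/q}$ is finite; $|f|_{\mathcal B^s_{p,q}}$ is the infimum of the costs of all such representations of $f$. Moreover let $$osc_p(f,Q)=\inf_{c\in\mathbb C}\Big(\int_Q|f-c|^p\,dm\Big)^{1/p},\qquad osc^s_{p,q}(f)=\Big(\sum_k\big(\sum_{Q\in\mathcal P^k}|Q|^{-sp}\,osc_p(f,Q)^p\big)^{q/p}\Big)^{1/q}\in[0,\infty].$$ For $q=\infty$ the outer $\ell^q$ norm over $k$ is replaced by a supremum. **Proposition 19.1.** Let $g\colon\mathbb C\to\mathbb C$ be Lipschitz with constant $K$ and $g(0)=0$. Then the left composition $L_g\colon\mathcal B^s_{p,q}\to\mathcal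 B^s_{p,q}$, $L_g(f)=g\circ f$, is well defined (it respects equality almost everywhere, and $f\in\mathcal B^s_{p,q}$ implies $g\circ f\in\mathcal B^s_{p,q}$), and for every $f\in L^p(m)$, in particular for every $f\in\mathcal B^s_{p,q}$, $$|g\circ f|_p+osc^s_{p,q}(g\circ f)\le K\big(|f|_p+osc^s_{p,q}(f)\big)$$ (in $[0,\infty]$, with $0\cdot\infty=0$). Consequently there is a finite constant $C$ such that $$|L_g(f)|_{\mathcal B^s_{p,q}}\le C\,|f|_{\mathcal B^s_{p,q}}\qquad\text{for every } f\in\mathcal B^s_{p,q}.$$ -/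

import Mathlib

open MeasureTheory Filter Topology
open scoped ENNReal NNReal

namespace BesovGrid

variable {I : Type*} [MeasurableSpace I]

/-- A grid: a sequence `P 0, P 1, …` of finite families of measurable sets of positive measure,
at least one of them nonempty, with bounded multiplicity inside each level, and such that
different levels have no member in common. -/
structure IsGrid (m : Measure I) (P : ℕ → Finset (Set I)) : Prop where
  measurableSet : ∀ k, ∀ Q ∈ P k, MeasurableSet Q
  measure_pos : ∀ k, ∀ Q ∈ P k, 0 < m Q
  exists_nonempty : ∃ k, (P k).Nonempty
  multiplicity : ∃ N : ℕ, ∀ k, ∀ Q ∈ P k, {R | R ∈ P k ∧ (R ∩ Q).Nonempty}.ncard ≤ N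
  levels_ne : ∀ i j, i ≠ j → ∀ Q ∈ P i, ∀ R ∈ P j, Q ≠ R

/-- A `(l₁, l₂)`-good grid. -/
structure IsGoodGrid (m : Measure I) (P : ℕ → Finset (Set I)) (l₁ l₂ : ℝ) : Prop
    extends IsGrid m P where
  pos : 0 < l₁
  lt : l₁ < l₂
  lt_one : l₂ < 1
  level_zero : P 0 = {Set.univ}
  cover : ∀ k, m (⋃ Q ∈ P k, Q)ᶜ = 0
  disjoint : ∀ k, ∀ Q ∈ P k, ∀ R ∈ P k, Q ≠ R → Disjoint Q R
  nested : ∀ k, ∀ Q ∈ P (k + 1), ∃ R ∈ P k, Q ⊆ R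
  ratio : ∀ k, ∀ R ∈ P k, ∀ Q ∈ P (k + 1), Q ⊆ R →
    l₁ ≤ m.real Q / m.real R ∧ m.real Q / m.real R ≤ l₂
  generate : ‹MeasurableSpace I› = MeasurableSpace.generateFrom {Q | ∃ k, Q ∈ P k}

/-- The `ℓ^q` norm of a sequence in `[0, ∞]`, with the supremum for `q = ∞`. -/
noncomputable def lqNorm (q : ℝ≥0∞) (x : ℕ → ℝ≥0∞) : ℝ≥0∞ :=
  if q = ∞ then ⨆ k, x k else (∑' k, x k ^ q.toReal) ^ (1 / q.toReal)

/-- The set of `(s, p)`-Souza atoms supported on `Q`: functions that vanish off `Q`, are constant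
on `Q` and are bounded by `|Q| ^ (s - 1 / p)`. -/
def souzaAtoms (m : Measure I) (s p : ℝ) (Q : Set I) : Set (I → ℂ) :=
  {a | (∀ x, x ∉ Q → a x = 0) ∧ (∀ x ∈ Q, ∀ y ∈ Q, a x = a y) ∧
    ∀ x, ‖a x‖ ≤ m.real Q ^ (s - 1 / p)}

/-- The cost `(∑_k (∑_{Q ∈ P k} |c_Q|^p)^{q/p})^{1/q}` of a family of coefficients. -/
noncomputable def cost (P : ℕ → Finset (Set I)) (p : ℝ) (q : ℝ≥0∞) (c : Set I → ℂ) : ℝ≥0∞ :=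
  lqNorm q fun k => (∑ Q ∈ P k, ‖c Q‖ₑ ^ p) ^ (1 / p)

/-- `f = ∑_k ∑_{Q ∈ P k} c_Q a_Q` is a representation of `f` by Souza atoms: the series (over `k`)
converges absolutely in `L^p`, its sum is `f`, and the cost is finite (here `1 ≤ p < ∞`). -/
structure IsRepresentation (m : Measure I) (P : ℕ → Finset (Set I)) (s p : ℝ) (q : ℝ≥0∞)
    (f : I → ℂ) (c : Set I → ℂ) (a : Set I → I → ℂ) : Prop where
  atom : ∀ k, ∀ Q ∈ P k, a Q ∈ souzaAtoms m s p Q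
  summable : ∑' k, eLpNorm (fun x => ∑ Q ∈ P k, c Q * a Q x) (ENNReal.ofReal p) m < ∞
  tendsto : Tendsto (fun n => eLpNorm
    (fun x => f x - ∑ k ∈ Finset.range n, ∑ Q ∈ P k, c Q * a Q x) (ENNReal.ofReal p) m)
    atTop (𝓝 0)
  cost_lt_top : cost P p q c < ∞

/-- `f` belongs to the Besov space `𝓑^s_{p,q}` of the grid `P`. -/
def MemBesov (m : Measure I) (P : ℕ → Finset (Set I)) (s p : ℝ) (q : ℝ≥0∞) (f : I → ℂ) : Prop :=
  MemLp f (ENNReal.ofReal p) m ∧ ∃ c a, IsRepresentation m P s p q f c a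

/-- The norm `|f|_{𝓑^s_{p,q}}`: the infimum of the costs of all representations of `f`. -/
noncomputable def besovNorm (m : Measure I) (P : ℕ → Finset (Set I)) (s p : ℝ) (q : ℝ≥0∞)
    (f : I → ℂ) : ℝ≥0∞ :=
  sInf {t | ∃ c a, IsRepresentation m P s p q f c a ∧ t = cost P p q c}

/-- The local mean oscillation `osc_p(f, Q) = inf_c (∫_Q |f - c|^p dm)^{1/p}`. -/
noncomputable def osc (m : Measure I) (p : ℝ) (f : I → ℂ) (Q : Set I) : ℝ≥0∞ :=
  ⨅ c : ℂ, (∫⁻ x in Q, ‖f x - c‖ₑ ^ p ∂m) ^ (1 / p)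

/-- `osc^s_{p,q}(f) = (∑_k (∑_{Q ∈ P k} |Q|^{-sp} osc_p(f, Q)^p)^{q/p})^{1/q}`. -/
noncomputable def oscNorm (m : Measure I) (P : ℕ → Finset (Set I)) (s p : ℝ) (q : ℝ≥0∞)
    (f : I → ℂ) : ℝ≥0∞ :=
  lqNorm q fun k => (∑ Q ∈ P k, m Q ^ (-(s * p)) * osc m p f Q ^ p) ^ (1 / p)

end BesovGrid

/-!
Let `μ_k` be the measure `m` with the weight `|Q|^{-sp}` on each cell `Q` of level `k`. For `μ_k`,
Souza atoms of level `k` have `L^p` norm at most `1`, and the level-`k` term of the oscillation norm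
is the `L^p(μ_k)` distance from `f` to the functions constant on the cells of level `k`. Since
`λ₁ ≤ |Q|/|R| ≤ λ₂`, passing from `μ_k` to `μ_{k+1}` multiplies `L^p` norms by a factor between
`λ₂^{-s}` and `λ₁^{-s}`. Hence the atoms of level `k + j` contribute to the oscillation at level `k`
with the geometric factor `λ₂^{sj}`, while those of lower levels, being constant on the cells of
level `k`, contribute nothing; so the cost of a representation controls `|f|_p` and the oscillation
norm. Conversely, subtracting the cell means level by level produces a representation
whose cost at level `k + 1` is at most `2 λ₁^{-s}` times the oscillation at level `k`. The Besov
norm is therefore equivalent to `|f|_p` plus the oscillation norm, and a `K`-Lipschitz `g` with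
`g 0 = 0` increases each of these two at most by the factor `K`.
-/

namespace BesovGrid

section LqNorm

variable {q : ℝ≥0∞}

theorem lqNorm_mono {x y : ℕ → ℝ≥0∞} (h : ∀ k, x k ≤ y k) : lqNorm q x ≤ lqNorm q y := by
  unfold lqNorm
  split_ifs
  · exact iSup_mono h
  · gcongr with k
    exact h k

theorem lqNorm_const_mul (hq : q ≠ 0) (a : ℝ≥0∞) (x : ℕ → ℝ≥0∞) :
    lqNorm q (fun k => a * x k) = a * lqNorm q x := by
  unfold lqNorm
  split_ifs with h
  · rw [ENNReal.mul_iSup]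
  · have hq₀ : 0 < q.toReal := ENNReal.toReal_pos hq h
    simp_rw [ENNReal.mul_rpow_of_nonneg _ _ hq₀.le, ENNReal.tsum_mul_left]
    rw [ENNReal.mul_rpow_of_nonneg _ _ (by positivity), one_div, ENNReal.rpow_rpow_inv hq₀.ne']

theorem le_lqNorm (hq : q ≠ 0) (x : ℕ → ℝ≥0∞) (k : ℕ) : x k ≤ lqNorm q x := by
  unfold lqNorm
  split_ifs with h
  · exact le_iSup x k
  · rw [one_div, ENNReal.le_rpow_inv_iff (ENNReal.toReal_pos hq h)]
    exact ENNReal.le_tsum (f := fun k => x k ^ q.toReal) k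

theorem lqNorm_comp_add_right_le (x : ℕ → ℝ≥0∞) (j : ℕ) :
    lqNorm q (fun k => x (k + j)) ≤ lqNorm q x := by
  unfold lqNorm
  split_ifs
  · exact iSup_comp_le x (fun k => k + j)
  · refine ENNReal.rpow_le_rpow ?_ (by positivity)
    exact ENNReal.tsum_comp_le_tsum_of_injective (add_left_injective j) (fun k => x k ^ q.toReal)

theorem lqNorm_le_zero_add_succ (hq : 1 ≤ q) (x : ℕ → ℝ≥0∞) :
    lqNorm q x ≤ x 0 + lqNorm q (fun k => x (k + 1)) := by
  unfold lqNorm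
  split_ifs with h
  · refine iSup_le fun k => ?_
    cases k with
    | zero => exact le_self_add
    | succ k => exact le_add_left (le_iSup (fun k => x (k + 1)) k)
  · have hq₁ : 1 ≤ q.toReal := by simpa using ENNReal.toReal_mono h hq
    have hq₀ : 0 < q.toReal := by positivity
    calc (∑' k, x k ^ q.toReal) ^ (1 / q.toReal)
        = (x 0 ^ q.toReal + ∑' k, x (k + 1) ^ q.toReal) ^ (1 / q.toReal) := by
          rw [tsum_eq_zero_add' ENNReal.summable]
      _ ≤ (x 0 ^ q.toReal) ^ (1 / q.toReal) +
            (∑' k, x (k + 1) ^ q.toReal) ^ (1 / q.toReal) :=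
          ENNReal.rpow_add_le_add_rpow _ _ (by positivity) ((div_le_one hq₀).2 hq₁)
      _ = _ := by rw [one_div, ENNReal.rpow_rpow_inv hq₀.ne']

theorem lqNorm_eq_eLpNorm_count (hq : q ≠ 0) (x : ℕ → ℝ≥0∞) :
    lqNorm q x = eLpNorm x q Measure.count := by
  unfold lqNorm
  split_ifs with h
  · subst h
    simp [eLpNormEssSup_eq_iSup]
  · rw [eLpNorm_eq_lintegral_rpow_enorm_toReal hq h, lintegral_count]
    simp

theorem lqNorm_sum_le {ι : Type*} (hq : 1 ≤ q) (x : ι → ℕ → ℝ≥0∞) (s : Finset ι) :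
    lqNorm q (fun k => ∑ j ∈ s, x j k) ≤ ∑ j ∈ s, lqNorm q (x j) := by
  simp_rw [lqNorm_eq_eLpNorm_count (one_pos.trans_le hq).ne']
  rw [← Finset.sum_fn]
  exact eLpNorm_sum_le (fun i _ => Measurable.of_discrete.aestronglyMeasurable) hq

theorem lqNorm_tsum_le (hq : 1 ≤ q) (x : ℕ → ℕ → ℝ≥0∞) :
    lqNorm q (fun k => ∑' j, x j k) ≤ ∑' j, lqNorm q (x j) := by
  have hpartial : ∀ n, lqNorm q (fun k => ∑ j ∈ Finset.range n, x j k) ≤ ∑' j, lqNorm q (x j) :=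
    fun n => (lqNorm_sum_le hq x _).trans (ENNReal.sum_le_tsum _)
  rcases eq_or_ne q ∞ with h | h
  · subst h
    simp only [lqNorm, if_true]
    exact iSup_le fun k => ENNReal.tsum_le_tsum fun j => le_iSup (x j) k
  · have hq₀ : 0 < q.toReal := ENNReal.toReal_pos (one_pos.trans_le hq).ne' h
    simp only [lqNorm, if_neg h, one_div, ENNReal.rpow_inv_le_iff hq₀] at hpartial ⊢
    rw [ENNReal.tsum_eq_iSup_sum]
    refine iSup_le fun t => ?_
    have hlim : Tendsto (fun n => ∑ k ∈ t, (∑ j ∈ Finset.range n, x j k) ^ q.toReal) atTop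
        (𝓝 (∑ k ∈ t, (∑' j, x j k) ^ q.toReal)) :=
      tendsto_finsetSum _ fun k _ =>
        (ENNReal.continuous_rpow_const.tendsto _).comp (ENNReal.tendsto_nat_tsum fun j => x j k)
    exact le_of_tendsto' hlim fun n => (ENNReal.sum_le_tsum t).trans (hpartial n)

theorem lqNorm_tsum_pow_mul_le (hq : 1 ≤ q) (r : ℝ≥0∞) (y : ℕ → ℝ≥0∞) :
    lqNorm q (fun k => ∑' j, r ^ j * y (k + j)) ≤ (1 - r)⁻¹ * lqNorm q y :=
  calc lqNorm q (fun k => ∑' j, r ^ j * y (k + j))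
      ≤ ∑' j, lqNorm q (fun k => r ^ j * y (k + j)) :=
        lqNorm_tsum_le hq fun j k => r ^ j * y (k + j)
    _ ≤ ∑' j, r ^ j * lqNorm q y := by
        gcongr with j
        rw [lqNorm_const_mul (one_pos.trans_le hq).ne']
        gcongr
        exact lqNorm_comp_add_right_le y j
    _ = (1 - r)⁻¹ * lqNorm q y := by rw [ENNReal.tsum_mul_right, ENNReal.tsum_geometric]

end LqNorm

variable {I E : Type*} [MeasurableSpace I] [NormedAddCommGroup E]

section ELpNorm

variable {μ ν : Measure I}

theorem eLpNorm_ofReal_eq_lintegral {p : ℝ} (hp : 0 < p) (f : I → E) :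
    eLpNorm f (ENNReal.ofReal p) μ = (∫⁻ x, ‖f x‖ₑ ^ p ∂μ) ^ (1 / p) := by
  rw [eLpNorm_eq_lintegral_rpow_enorm_toReal (by simpa using hp) ENNReal.ofReal_ne_top,
    ENNReal.toReal_ofReal hp.le]

theorem eLpNorm_le_mul_of_measure_le_rpow_smul {p : ℝ} (hp : 0 < p) {C : ℝ≥0∞}
    (h : ν ≤ C ^ p • μ) (f : I → E) :
    eLpNorm f (ENNReal.ofReal p) ν ≤ C * eLpNorm f (ENNReal.ofReal p) μ := by
  refine (eLpNorm_mono_measure f h).trans_eq ?_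
  rw [eLpNorm_smul_measure_of_ne_top ENNReal.ofReal_ne_top, ENNReal.toReal_div,
    ENNReal.toReal_ofReal hp.le, ENNReal.toReal_one, one_div, ENNReal.rpow_rpow_inv hp.ne',
    smul_eq_mul]

theorem eLpNorm_le_tsum_of_tendsto {p : ℝ≥0∞} (hp : 1 ≤ p) {f : I → E} {u : ℕ → I → E}
    (hf : AEStronglyMeasurable f μ) (hu : ∀ k, AEStronglyMeasurable (u k) μ)
    (h : Tendsto (fun n => eLpNorm (f - ∑ k ∈ Finset.range n, u k) p μ) atTop (𝓝 0)) :
    eLpNorm f p μ ≤ ∑' k, eLpNorm (u k) p μ := by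
  have hpartial : ∀ n, eLpNorm f p μ ≤
      eLpNorm (f - ∑ k ∈ Finset.range n, u k) p μ + ∑' k, eLpNorm (u k) p μ := fun n => by
    have hS : AEStronglyMeasurable (∑ k ∈ Finset.range n, u k) μ :=
      Finset.aestronglyMeasurable_sum _ fun k _ => hu k
    calc eLpNorm f p μ
        = eLpNorm (f - ∑ k ∈ Finset.range n, u k + ∑ k ∈ Finset.range n, u k) p μ := by
          rw [sub_add_cancel]
      _ ≤ _ := eLpNorm_add_le (hf.sub hS) hS hp
      _ ≤ _ := by
          gcongr
          exact (eLpNorm_sum_le (fun k _ => hu k) hp).trans (ENNReal.sum_le_tsum _)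
  simpa using ge_of_tendsto' (h.add_const _) hpartial

variable [NormedSpace ℝ E] [IsFiniteMeasure μ]

theorem eLpNorm_const_average_le {p : ℝ≥0∞} (hp : 1 ≤ p) {f : I → E}
    (hf : AEStronglyMeasurable f μ) :
    eLpNorm (fun _ => ⨍ x, f x ∂μ) p μ ≤ eLpNorm f p μ := by
  rcases eq_zero_or_neZero μ with rfl | hμ
  · simp
  set ρ : Measure I := (μ Set.univ)⁻¹ • μ with hρ
  have hμ₀ : μ Set.univ ≠ 0 := NeZero.ne _
  have hfρ : AEStronglyMeasurable f ρ := hf.smul_measure _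
  have hprob : eLpNorm (fun _ => ⨍ x, f x ∂μ) p ρ ≤ eLpNorm f p ρ :=
    calc eLpNorm (fun _ => ⨍ x, f x ∂μ) p ρ = ‖∫ x, f x ∂ρ‖ₑ := by
          rw [eLpNorm_const _ (one_pos.trans_le hp).ne' (NeZero.ne ρ), measure_univ,
            ENNReal.one_rpow, mul_one, average]
      _ ≤ eLpNorm f 1 ρ := by
          rw [eLpNorm_one_eq_lintegral_enorm]
          exact enorm_integral_le_lintegral_enorm f
      _ ≤ eLpNorm f p ρ := eLpNorm_le_eLpNorm_of_exponent_le hp hfρ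
  have hμρ : μ = μ Set.univ • ρ := by
    rw [hρ, smul_smul, ENNReal.mul_inv_cancel hμ₀ (measure_ne_top μ _), one_smul]
  have hscale : ∀ h : I → E, eLpNorm h p μ = μ Set.univ ^ (1 / p).toReal • eLpNorm h p ρ :=
    fun h => by
      conv_lhs => rw [hμρ]
      exact eLpNorm_smul_measure_of_ne_zero hμ₀ h p ρ
  rw [hscale, hscale f]
  gcongr

theorem eLpNorm_sub_average_le [CompleteSpace E] {p : ℝ≥0∞} (hp : 1 ≤ p) {f : I → E}
    (hf : MemLp f p μ) (b : E) :
    eLpNorm (fun x => f x - ⨍ y, f y ∂μ) p μ ≤ 2 * eLpNorm (fun x => f x - b) p μ := by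
  rcases eq_zero_or_neZero μ with rfl | hμ
  · simp
  have hfb : AEStronglyMeasurable (fun x => f x - b) μ :=
    hf.aestronglyMeasurable.sub aestronglyMeasurable_const
  have haverage : ⨍ y, (f y - b) ∂μ = (⨍ y, f y ∂μ) - b := by
    have hint : Integrable f μ := hf.integrable hp
    simp only [average_eq, integral_sub hint (integrable_const b), integral_const, smul_sub]
    rw [inv_smul_smul₀ (by simp [measureReal_eq_zero_iff, NeZero.ne])]
  calc eLpNorm (fun x => f x - ⨍ y, f y ∂μ) p μ
      = eLpNorm ((fun x => f x - b) - fun _ => ⨍ y, (f y - b) ∂μ) p μ := by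
        congr 1
        ext x
        simp [haverage]
    _ ≤ eLpNorm (fun x => f x - b) p μ + eLpNorm (fun _ => ⨍ y, (f y - b) ∂μ) p μ :=
        eLpNorm_sub_le hfb aestronglyMeasurable_const hp
    _ ≤ 2 * eLpNorm (fun x => f x - b) p μ := by
        rw [two_mul]
        gcongr
        exact eLpNorm_const_average_le hp hfb

end ELpNorm

section CellNorm

variable {m : Measure I} {s p : ℝ} {F : Finset (Set I)}

/-- The weighted `ℓ^p` norm `(∑_{Q ∈ F} |Q|^{-sp} x_Q^p)^{1/p}` of a family indexed by the cells
of a level `F`; the oscillation norm is the `ℓ^q` norm over the levels of `cellNorm` of `osc`. -/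
noncomputable def cellNorm (m : Measure I) (s p : ℝ) (F : Finset (Set I)) (x : Set I → ℝ≥0∞) :
    ℝ≥0∞ :=
  (∑ Q ∈ F, m Q ^ (-(s * p)) * x Q ^ p) ^ (1 / p)

/-- The measure obtained from `m` by giving each cell `Q` of a level `F` the weight `|Q|^{-sp}`.
Souza atoms on the cells of `F` have `L^p` norm at most `1` for it. -/
noncomputable def cellMeasure (m : Measure I) (s p : ℝ) (F : Finset (Set I)) : Measure I :=
  ∑ Q ∈ F, m Q ^ (-(s * p)) • m.restrict Q

theorem cellNorm_mono (hp : 0 < p) {x y : Set I → ℝ≥0∞} (h : ∀ Q ∈ F, x Q ≤ y Q) :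
    cellNorm m s p F x ≤ cellNorm m s p F y := by
  unfold cellNorm
  gcongr with Q hQ
  exact h Q hQ

theorem cellNorm_const_mul (hp : 0 < p) (K : ℝ≥0∞) (x : Set I → ℝ≥0∞) :
    cellNorm m s p F (fun Q => K * x Q) = K * cellNorm m s p F x := by
  simp_rw [cellNorm, ENNReal.mul_rpow_of_nonneg _ _ hp.le, mul_left_comm _ (K ^ p),
    ← Finset.mul_sum]
  rw [ENNReal.mul_rpow_of_nonneg _ _ (by positivity), one_div, ENNReal.rpow_rpow_inv hp.ne']

theorem eLpNorm_cellMeasure (hp : 0 < p) (f : I → E) :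
    eLpNorm f (ENNReal.ofReal p) (cellMeasure m s p F) =
      cellNorm m s p F fun Q => eLpNorm f (ENNReal.ofReal p) (m.restrict Q) := by
  simp_rw [cellNorm, eLpNorm_ofReal_eq_lintegral hp, cellMeasure, lintegral_finsetSum_measure,
    lintegral_smul_measure, smul_eq_mul, one_div, ENNReal.rpow_inv_rpow hp.ne']

theorem cellMeasure_absolutelyContinuous : cellMeasure m s p F ≪ m := by
  intro B hB
  simp only [cellMeasure, Measure.coe_finsetSum, Finset.sum_apply, Measure.smul_apply, smul_eq_mul]
  exact Finset.sum_eq_zero fun Q _ => by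
    rw [Measure.absolutelyContinuous_restrict hB, mul_zero]

theorem restrict_cellMeasure (hF : (F : Set (Set I)).PairwiseDisjoint id) {Q R : Set I}
    (hR : R ∈ F) (hQR : Q ⊆ R) (hQ : MeasurableSet Q) :
    (cellMeasure m s p F).restrict Q = m R ^ (-(s * p)) • m.restrict Q := by
  ext B hB
  simp only [cellMeasure, Measure.restrict_apply hB, Measure.coe_finsetSum, Finset.sum_apply,
    Measure.smul_apply, smul_eq_mul, Measure.restrict_apply (hB.inter hQ)]
  rw [Finset.sum_eq_single_of_mem R hR, Set.inter_assoc, Set.inter_eq_left.2 hQR]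
  intro S hS hne
  have hdisj : Disjoint Q S := (hF hR hS hne.symm).mono_left hQR
  rw [Set.inter_assoc, hdisj.inter_eq, Set.inter_empty, measure_empty, mul_zero]

theorem measure_le_of_forall_restrict_le {μ ν : Measure I}
    (hF : (F : Set (Set I)).PairwiseDisjoint id) (hmeas : ∀ Q ∈ F, MeasurableSet Q)
    (hcover : ν (⋃ Q ∈ F, Q)ᶜ = 0) (h : ∀ Q ∈ F, ν.restrict Q ≤ μ.restrict Q) : ν ≤ μ := by
  refine Measure.le_iff.2 fun B hB => ?_
  have hsum : ∀ ρ : Measure I, ρ.restrict (⋃ Q ∈ F, Q) B = ∑ Q ∈ F, ρ.restrict Q B := fun ρ => by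
    simp_rw [Measure.restrict_apply hB, Set.inter_iUnion]
    exact measure_biUnion_finset
      (fun Q hQ R hR hne => (hF hQ hR hne).mono Set.inter_subset_right Set.inter_subset_right)
      fun Q hQ => hB.inter (hmeas Q hQ)
  calc ν B = ν.restrict (⋃ Q ∈ F, Q) B := by
        rw [Measure.restrict_eq_self_of_ae_mem (show ∀ᵐ x ∂ν, x ∈ ⋃ Q ∈ F, Q from hcover)]
    _ ≤ μ.restrict (⋃ Q ∈ F, Q) B := by
        rw [hsum, hsum]
        exact Finset.sum_le_sum fun Q hQ => h Q hQ B
    _ ≤ μ B := Measure.restrict_apply_le _ _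

end CellNorm

section CellwiseConst

variable {α β : Type*}

/-- The function `u` is constant on each cell of the level `F`. -/
def CellwiseConst (F : Finset (Set α)) (u : α → β) : Prop :=
  ∀ Q ∈ F, ∃ b, Set.EqOn u (fun _ => b) Q

theorem CellwiseConst.sum {ι : Type*} [AddCommMonoid β] {F : Finset (Set α)} {u : ι → α → β}
    {t : Finset ι} (h : ∀ i ∈ t, CellwiseConst F (u i)) : CellwiseConst F (∑ i ∈ t, u i) := by
  intro Q hQ
  choose! b hb using fun i hi => h i hi Q hQ
  refine ⟨∑ i ∈ t, b i, fun x hx => ?_⟩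
  rw [Finset.sum_apply]
  exact Finset.sum_congr rfl fun i hi => hb i hi hx

end CellwiseConst

theorem rpow_neg_le_rpow_neg {a b : ℝ≥0∞} {t : ℝ} (ht : 0 ≤ t) (h : a ≤ b) :
    b ^ (-t) ≤ a ^ (-t) := by
  rw [ENNReal.rpow_neg, ENNReal.rpow_neg]
  gcongr

section Grid

variable {m : Measure I} {P : ℕ → Finset (Set I)} {l₁ l₂ s p : ℝ}

theorem IsGoodGrid.univ_mem (hP : IsGoodGrid m P l₁ l₂) : Set.univ ∈ P 0 := by
  simp [hP.level_zero]

theorem IsGoodGrid.pairwiseDisjoint (hP : IsGoodGrid m P l₁ l₂) (k : ℕ) :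
    (P k : Set (Set I)).PairwiseDisjoint id :=
  fun Q hQ R hR => hP.disjoint k Q hQ R hR

theorem IsGrid.measure_ne_zero (hP : IsGrid m P) {k : ℕ} {Q : Set I} (hQ : Q ∈ P k) : m Q ≠ 0 :=
  (hP.measure_pos k Q hQ).ne'

theorem IsGrid.measureReal_pos [IsFiniteMeasure m] (hP : IsGrid m P) {k : ℕ} {Q : Set I}
    (hQ : Q ∈ P k) : 0 < m.real Q :=
  ENNReal.toReal_pos (hP.measure_ne_zero hQ) (measure_ne_top m Q)

theorem IsGrid.exists_forall_level_eq {α : Type*} [Nonempty α] (hP : IsGrid m P)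
    (u : ℕ → Set I → α) : ∃ c : Set I → α, ∀ k, ∀ Q ∈ P k, c Q = u k Q := by
  have hcell : ∀ Q, ∃ b, ∀ k, Q ∈ P k → b = u k Q := fun Q => by
    by_cases hQ : ∃ k, Q ∈ P k
    · obtain ⟨k, hk⟩ := hQ
      refine ⟨u k Q, fun j hj => ?_⟩
      rcases eq_or_ne k j with rfl | hne
      · rfl
      · exact absurd rfl (hP.levels_ne k j hne Q hk Q hj)
    · exact ⟨Classical.arbitrary α, fun k hk => absurd ⟨k, hk⟩ hQ⟩
  choose c hc using hcell
  exact ⟨c, fun k Q hQ => hc Q k hQ⟩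

theorem IsGoodGrid.exists_superset (hP : IsGoodGrid m P l₁ l₂) {i k : ℕ} (hik : i ≤ k) :
    ∀ Q ∈ P k, ∃ R ∈ P i, Q ⊆ R := by
  induction k, hik using Nat.le_induction with
  | base => exact fun Q hQ => ⟨Q, hQ, subset_rfl⟩
  | succ k _ ih =>
    intro Q hQ
    obtain ⟨S, hS, hQS⟩ := hP.nested k Q hQ
    obtain ⟨R, hR, hSR⟩ := ih S hS
    exact ⟨R, hR, hQS.trans hSR⟩

theorem IsGoodGrid.cellwiseConst_of_le {α : Type*} (hP : IsGoodGrid m P l₁ l₂) {i k : ℕ}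
    (hik : i ≤ k) {u : I → α} (hu : CellwiseConst (P i) u) : CellwiseConst (P k) u := by
  intro Q hQ
  obtain ⟨R, hR, hQR⟩ := hP.exists_superset hik Q hQ
  obtain ⟨b, hb⟩ := hu R hR
  exact ⟨b, hb.mono hQR⟩

theorem IsGoodGrid.rpow_lt_one (hP : IsGoodGrid m P l₁ l₂) (hs : 0 < s) :
    ENNReal.ofReal l₂ ^ s < 1 :=
  ENNReal.rpow_lt_one (ENNReal.ofReal_lt_one.2 hP.lt_one) hs

theorem IsGoodGrid.inv_one_sub_rpow_lt_top (hP : IsGoodGrid m P l₁ l₂) (hs : 0 < s) :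
    (1 - ENNReal.ofReal l₂ ^ s)⁻¹ < ∞ :=
  ENNReal.inv_lt_top.2 (tsub_pos_of_lt (hP.rpow_lt_one hs))

theorem IsGoodGrid.eLpNorm_cellMeasure_zero (hP : IsGoodGrid m P l₁ l₂) (hp : 0 < p) (f : I → E) :
    eLpNorm f (ENNReal.ofReal p) (cellMeasure m s p (P 0)) =
      m Set.univ ^ (-s) * eLpNorm f (ENNReal.ofReal p) m := by
  simp only [eLpNorm_cellMeasure hp, cellNorm, hP.level_zero, Finset.sum_singleton,
    Measure.restrict_univ]
  rw [← neg_mul, ENNReal.rpow_mul, ← ENNReal.mul_rpow_of_nonneg _ _ hp.le, one_div,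
    ENNReal.rpow_rpow_inv hp.ne']

variable [IsFiniteMeasure m]

theorem IsGoodGrid.measure_le_mul (hP : IsGoodGrid m P l₁ l₂) {k : ℕ} {Q R : Set I} (hR : R ∈ P k)
    (hQ : Q ∈ P (k + 1)) (hQR : Q ⊆ R) : m Q ≤ ENNReal.ofReal l₂ * m R := by
  rw [← ofReal_measureReal (measure_ne_top m Q), ← ofReal_measureReal (measure_ne_top m R),
    ← ENNReal.ofReal_mul (hP.pos.trans hP.lt).le]
  exact ENNReal.ofReal_le_ofReal
    ((div_le_iff₀ (hP.measureReal_pos hR)).1 (hP.ratio k R hR Q hQ hQR).2)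

theorem IsGoodGrid.mul_measure_le (hP : IsGoodGrid m P l₁ l₂) {k : ℕ} {Q R : Set I} (hR : R ∈ P k)
    (hQ : Q ∈ P (k + 1)) (hQR : Q ⊆ R) : ENNReal.ofReal l₁ * m R ≤ m Q := by
  rw [← ofReal_measureReal (measure_ne_top m Q), ← ofReal_measureReal (measure_ne_top m R),
    ← ENNReal.ofReal_mul hP.pos.le]
  exact ENNReal.ofReal_le_ofReal
    ((le_div_iff₀ (hP.measureReal_pos hR)).1 (hP.ratio k R hR Q hQ hQR).1)

theorem IsGoodGrid.cellMeasure_le_succ (hP : IsGoodGrid m P l₁ l₂) (hp : 0 < p) (hs : 0 < s)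
    (k : ℕ) :
    cellMeasure m s p (P k) ≤ (ENNReal.ofReal l₂ ^ s) ^ p • cellMeasure m s p (P (k + 1)) := by
  refine measure_le_of_forall_restrict_le (hP.pairwiseDisjoint (k + 1)) (hP.measurableSet (k + 1))
    (cellMeasure_absolutelyContinuous (hP.cover (k + 1))) fun Q hQ => ?_
  obtain ⟨R, hR, hQR⟩ := hP.nested k Q hQ
  have hQm := hP.measurableSet (k + 1) Q hQ
  rw [Measure.restrict_smul, restrict_cellMeasure (hP.pairwiseDisjoint k) hR hQR hQm,
    restrict_cellMeasure (hP.pairwiseDisjoint (k + 1)) hQ subset_rfl hQm, smul_smul,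
    ← ENNReal.rpow_mul]
  gcongr
  set t := s * p
  have ht : 0 < t := mul_pos hs hp
  have hl₂ : ENNReal.ofReal l₂ ≠ 0 := by simpa using hP.pos.trans hP.lt
  calc m R ^ (-t) = ENNReal.ofReal l₂ ^ t * (ENNReal.ofReal l₂ * m R) ^ (-t) := by
        rw [ENNReal.mul_rpow_of_ne_top ENNReal.ofReal_ne_top (measure_ne_top m R), ← mul_assoc,
          ← ENNReal.rpow_add _ _ hl₂ ENNReal.ofReal_ne_top, add_neg_cancel, ENNReal.rpow_zero,
          one_mul]
    _ ≤ ENNReal.ofReal l₂ ^ t * m Q ^ (-t) := by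
        gcongr _ * ?_
        exact rpow_neg_le_rpow_neg ht.le (hP.measure_le_mul hR hQ hQR)

theorem IsGoodGrid.cellMeasure_succ_le (hP : IsGoodGrid m P l₁ l₂) (hp : 0 < p) (hs : 0 < s)
    (k : ℕ) :
    cellMeasure m s p (P (k + 1)) ≤
      (ENNReal.ofReal l₁ ^ (-s)) ^ p • cellMeasure m s p (P k) := by
  refine measure_le_of_forall_restrict_le (hP.pairwiseDisjoint (k + 1)) (hP.measurableSet (k + 1))
    (cellMeasure_absolutelyContinuous (hP.cover (k + 1))) fun Q hQ => ?_
  obtain ⟨R, hR, hQR⟩ := hP.nested k Q hQ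
  have hQm := hP.measurableSet (k + 1) Q hQ
  rw [Measure.restrict_smul, restrict_cellMeasure (hP.pairwiseDisjoint k) hR hQR hQm,
    restrict_cellMeasure (hP.pairwiseDisjoint (k + 1)) hQ subset_rfl hQm, smul_smul,
    ← ENNReal.rpow_mul, neg_mul,
    ← ENNReal.mul_rpow_of_ne_top ENNReal.ofReal_ne_top (measure_ne_top m R)]
  gcongr ?_ • _
  exact rpow_neg_le_rpow_neg (mul_pos hs hp).le (hP.mul_measure_le hR hQ hQR)

theorem IsGoodGrid.eLpNorm_cellMeasure_le_pow_mul (hP : IsGoodGrid m P l₁ l₂) (hp : 0 < p)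
    (hs : 0 < s) (f : I → E) (k j : ℕ) :
    eLpNorm f (ENNReal.ofReal p) (cellMeasure m s p (P k)) ≤
      (ENNReal.ofReal l₂ ^ s) ^ j *
        eLpNorm f (ENNReal.ofReal p) (cellMeasure m s p (P (k + j))) := by
  induction j with
  | zero => simp
  | succ j ih =>
    rw [pow_succ, mul_assoc]
    refine ih.trans ?_
    gcongr
    exact eLpNorm_le_mul_of_measure_le_rpow_smul hp (hP.cellMeasure_le_succ hp hs (k + j)) f

theorem IsGoodGrid.eLpNorm_cellMeasure_succ_le (hP : IsGoodGrid m P l₁ l₂) (hp : 0 < p)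
    (hs : 0 < s) (f : I → E) (k : ℕ) :
    eLpNorm f (ENNReal.ofReal p) (cellMeasure m s p (P (k + 1))) ≤
      ENNReal.ofReal l₁ ^ (-s) * eLpNorm f (ENNReal.ofReal p) (cellMeasure m s p (P k)) :=
  eLpNorm_le_mul_of_measure_le_rpow_smul hp (hP.cellMeasure_succ_le hp hs k) f

theorem IsGoodGrid.eLpNorm_cellMeasure_le (hP : IsGoodGrid m P l₁ l₂) (hp : 0 < p) (hs : 0 < s)
    (f : I → E) (k : ℕ) :
    eLpNorm f (ENNReal.ofReal p) (cellMeasure m s p (P k)) ≤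
      (ENNReal.ofReal l₁ ^ (-s)) ^ k * (m Set.univ ^ (-s) * eLpNorm f (ENNReal.ofReal p) m) := by
  induction k with
  | zero => simp [hP.eLpNorm_cellMeasure_zero hp]
  | succ k ih =>
    rw [pow_succ', mul_assoc]
    refine (hP.eLpNorm_cellMeasure_succ_le hp hs f k).trans ?_
    gcongr

theorem IsGoodGrid.eLpNorm_le_pow_mul_cellMeasure (hP : IsGoodGrid m P l₁ l₂) (hp : 0 < p)
    (hs : 0 < s) (f : I → E) (k : ℕ) :
    eLpNorm f (ENNReal.ofReal p) m ≤ m Set.univ ^ s * ((ENNReal.ofReal l₂ ^ s) ^ k *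
      eLpNorm f (ENNReal.ofReal p) (cellMeasure m s p (P k))) := by
  have hI : m Set.univ ^ s * m Set.univ ^ (-s) = 1 := by
    rw [← ENNReal.rpow_add _ _ (hP.measure_ne_zero hP.univ_mem) (measure_ne_top m _),
      add_neg_cancel, ENNReal.rpow_zero]
  have hlevel := hP.eLpNorm_cellMeasure_le_pow_mul hp hs f 0 k
  rw [hP.eLpNorm_cellMeasure_zero hp, zero_add] at hlevel
  calc eLpNorm f (ENNReal.ofReal p) m
      = m Set.univ ^ s * (m Set.univ ^ (-s) * eLpNorm f (ENNReal.ofReal p) m) := by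
        rw [← mul_assoc, hI, one_mul]
    _ ≤ _ := by gcongr

end Grid

section Oscillation

variable {m : Measure I} {P : ℕ → Finset (Set I)} {s p : ℝ} {q : ℝ≥0∞} {g : ℂ → ℂ} {K : ℝ≥0}

theorem oscNorm_eq_lqNorm_cellNorm (f : I → ℂ) :
    oscNorm m P s p q f = lqNorm q fun k => cellNorm m s p (P k) (osc m p f) :=
  rfl

theorem osc_eq_iInf_eLpNorm (hp : 0 < p) (f : I → ℂ) (Q : Set I) :
    osc m p f Q = ⨅ b : ℂ, eLpNorm (fun x => f x - b) (ENNReal.ofReal p) (m.restrict Q) := by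
  simp_rw [osc, eLpNorm_ofReal_eq_lintegral hp]

theorem osc_sub_of_eqOn {f u : I → ℂ} {Q : Set I} (hQ : MeasurableSet Q) {b : ℂ}
    (hu : Set.EqOn u (fun _ => b) Q) : osc m p (f - u) Q = osc m p f Q := by
  unfold osc
  rw [← (Equiv.subRight b).iInf_comp]
  congr! 3 with c
  exact setLIntegral_congr_fun hQ fun x hx => by simp [hu hx]

theorem osc_le_eLpNorm (hp : 0 < p) (f : I → ℂ) (Q : Set I) :
    osc m p f Q ≤ eLpNorm f (ENNReal.ofReal p) (m.restrict Q) := by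
  rw [osc_eq_iInf_eLpNorm hp]
  simpa using iInf_le (fun b => eLpNorm (fun x => f x - b) (ENNReal.ofReal p) (m.restrict Q)) 0

theorem cellNorm_osc_le_eLpNorm_sub (hp : 0 < p) {F : Finset (Set I)}
    (hF : ∀ Q ∈ F, MeasurableSet Q) (f : I → ℂ) {u : I → ℂ} (hu : CellwiseConst F u) :
    cellNorm m s p F (osc m p f) ≤ eLpNorm (f - u) (ENNReal.ofReal p) (cellMeasure m s p F) := by
  rw [eLpNorm_cellMeasure hp]
  refine cellNorm_mono hp fun Q hQ => ?_
  obtain ⟨b, hb⟩ := hu Q hQ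
  rw [← osc_sub_of_eqOn (hF Q hQ) hb]
  exact osc_le_eLpNorm hp _ Q

theorem enorm_sub_le_of_lipschitzWith {E' : Type*} [NormedAddCommGroup E'] {h : E → E'}
    (hh : LipschitzWith K h) (z w : E) : ‖h z - h w‖ₑ ≤ K * ‖z - w‖ₑ := by
  simpa only [edist_eq_enorm_sub] using hh z w

theorem eLpNorm_comp_le {E' : Type*} [NormedAddCommGroup E'] {h : E → E'}
    (hh : LipschitzWith K h) (hh0 : h 0 = 0) (r : ℝ≥0∞) (f : I → E) :
    eLpNorm (h ∘ f) r m ≤ K * eLpNorm f r m :=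
  eLpNorm_le_nnreal_smul_eLpNorm_of_ae_le_mul'
    (ae_of_all _ fun x => by simpa [hh0] using enorm_sub_le_of_lipschitzWith hh (f x) 0) _

theorem osc_comp_le (hp : 0 < p) (hg : LipschitzWith K g) (f : I → ℂ) (Q : Set I) :
    osc m p (g ∘ f) Q ≤ K * osc m p f Q := by
  rw [osc_eq_iInf_eLpNorm hp, osc_eq_iInf_eLpNorm hp, ENNReal.mul_iInf (by simp)]
  refine le_iInf fun b => (iInf_le _ (g b)).trans ?_
  exact eLpNorm_le_nnreal_smul_eLpNorm_of_ae_le_mul'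
    (ae_of_all _ fun x => enorm_sub_le_of_lipschitzWith hg (f x) b) _

theorem oscNorm_comp_le (hp : 0 < p) (hq : q ≠ 0) (hg : LipschitzWith K g) (f : I → ℂ) :
    oscNorm m P s p q (g ∘ f) ≤ K * oscNorm m P s p q f := by
  simp_rw [oscNorm_eq_lqNorm_cellNorm, ← lqNorm_const_mul hq, ← cellNorm_const_mul hp]
  exact lqNorm_mono fun k => cellNorm_mono hp fun Q _ => osc_comp_le hp hg f Q

end Oscillation

section SouzaAtoms

variable {m : Measure I} {s p : ℝ} {F : Finset (Set I)} {Q : Set I} {c : Set I → ℂ}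
  {a : Set I → I → ℂ}

/-- The contribution `∑_{Q ∈ F} c_Q a_Q` of a level `F` to an atomic representation. -/
def atomSum (F : Finset (Set I)) (c : Set I → ℂ) (a : Set I → I → ℂ) : I → ℂ :=
  fun x => ∑ Q ∈ F, c Q * a Q x

/-- The `ℓ^p` norm of the coefficients on a level `F`; the cost is the `ℓ^q` norm over the levels
of `coeffNorm`. -/
noncomputable def coeffNorm (p : ℝ) (F : Finset (Set I)) (c : Set I → ℂ) : ℝ≥0∞ :=
  (∑ Q ∈ F, ‖c Q‖ₑ ^ p) ^ (1 / p)

theorem coeffNorm_le_cost {α : Type*} {q : ℝ≥0∞} (hq : q ≠ 0) (P : ℕ → Finset (Set α)) (p : ℝ)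
    (c : Set α → ℂ) (k : ℕ) : coeffNorm p (P k) c ≤ cost P p q c :=
  le_lqNorm hq (fun k => coeffNorm p (P k) c) k

theorem exists_eq_indicator_of_mem_souzaAtoms {b : I → ℂ} (hb : b ∈ souzaAtoms m s p Q) :
    ∃ z, b = Q.indicator fun _ => z := by
  rcases Q.eq_empty_or_nonempty with rfl | ⟨y, hy⟩
  · exact ⟨0, funext fun x => by simp [hb.1 x]⟩
  · refine ⟨b y, funext fun x => ?_⟩
    by_cases hx : x ∈ Q
    · rw [Set.indicator_of_mem hx, hb.2.1 x hx y hy]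
    · rw [Set.indicator_of_notMem hx, hb.1 x hx]

theorem measurable_of_mem_souzaAtoms (hQ : MeasurableSet Q) {b : I → ℂ}
    (hb : b ∈ souzaAtoms m s p Q) : Measurable b := by
  obtain ⟨z, rfl⟩ := exists_eq_indicator_of_mem_souzaAtoms hb
  exact measurable_const.indicator hQ

theorem measurable_atomSum (hF : ∀ Q ∈ F, MeasurableSet Q)
    (ha : ∀ Q ∈ F, a Q ∈ souzaAtoms m s p Q) : Measurable (atomSum F c a) :=
  Finset.measurable_fun_sum _ fun Q hQ =>
    measurable_const.mul (measurable_of_mem_souzaAtoms (hF Q hQ) (ha Q hQ))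

theorem atomSum_apply_of_mem (hF : (F : Set (Set I)).PairwiseDisjoint id)
    (ha : ∀ Q ∈ F, a Q ∈ souzaAtoms m s p Q) (hQ : Q ∈ F) {x : I} (hx : x ∈ Q) :
    atomSum F c a x = c Q * a Q x := by
  refine Finset.sum_eq_single_of_mem Q hQ fun R hR hne => ?_
  rw [(ha R hR).1 x (Set.disjoint_left.1 (hF hQ hR hne.symm) hx), mul_zero]

theorem cellwiseConst_atomSum (hF : (F : Set (Set I)).PairwiseDisjoint id)
    (ha : ∀ Q ∈ F, a Q ∈ souzaAtoms m s p Q) : CellwiseConst F (atomSum F c a) := by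
  intro Q hQ
  obtain ⟨z, hz⟩ := exists_eq_indicator_of_mem_souzaAtoms (ha Q hQ)
  refine ⟨c Q * z, fun x hx => ?_⟩
  rw [atomSum_apply_of_mem hF ha hQ hx, hz, Set.indicator_of_mem hx]

variable [IsFiniteMeasure m]

theorem enorm_le_of_mem_souzaAtoms (hQ : m Q ≠ 0) {b : I → ℂ} (hb : b ∈ souzaAtoms m s p Q)
    (x : I) : ‖b x‖ₑ ≤ m Q ^ (s - 1 / p) := by
  have hQ' : 0 < m.real Q := ENNReal.toReal_pos hQ (measure_ne_top m Q)
  rw [← ofReal_norm, ← ofReal_measureReal (measure_ne_top m Q), ENNReal.ofReal_rpow_of_pos hQ']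
  exact ENNReal.ofReal_le_ofReal (hb.2.2 x)

theorem coeffNorm_eq_cellNorm (hp : 0 < p) (h₀ : ∀ Q ∈ F, m Q ≠ 0) :
    coeffNorm p F c = cellNorm m s p F fun Q => ‖c Q‖ₑ * m Q ^ s := by
  unfold coeffNorm cellNorm
  congr 1
  refine Finset.sum_congr rfl fun Q hQ => ?_
  rw [ENNReal.mul_rpow_of_nonneg _ _ hp.le, ← ENNReal.rpow_mul, mul_left_comm,
    ← ENNReal.rpow_add _ _ (h₀ Q hQ) (measure_ne_top m Q), neg_add_cancel, ENNReal.rpow_zero,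
    mul_one]

theorem eLpNorm_atomSum_le (hp : 0 < p) (hd : (F : Set (Set I)).PairwiseDisjoint id)
    (hF : ∀ Q ∈ F, MeasurableSet Q) (h₀ : ∀ Q ∈ F, m Q ≠ 0)
    (ha : ∀ Q ∈ F, a Q ∈ souzaAtoms m s p Q) :
    eLpNorm (atomSum F c a) (ENNReal.ofReal p) (cellMeasure m s p F) ≤ coeffNorm p F c := by
  rw [eLpNorm_cellMeasure hp, coeffNorm_eq_cellNorm hp h₀]
  refine cellNorm_mono hp fun Q hQ => ?_
  have hbound : ∀ᵐ x ∂m.restrict Q, ‖atomSum F c a x‖ₑ ≤ ‖c Q‖ₑ * m Q ^ (s - 1 / p) := by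
    filter_upwards [ae_restrict_mem (hF Q hQ)] with x hx
    rw [atomSum_apply_of_mem hd ha hQ hx, enorm_mul]
    gcongr
    exact enorm_le_of_mem_souzaAtoms (h₀ Q hQ) (ha Q hQ) x
  calc eLpNorm (atomSum F c a) (ENNReal.ofReal p) (m.restrict Q)
      ≤ ‖c Q‖ₑ * m Q ^ (s - 1 / p) * m Q ^ (1 / p) := by
        simpa [ENNReal.toReal_ofReal hp.le] using
          eLpNorm_le_of_ae_enorm_bound (p := ENNReal.ofReal p) hbound
    _ = ‖c Q‖ₑ * m Q ^ s := by
        rw [mul_assoc, ← ENNReal.rpow_add _ _ (h₀ Q hQ) (measure_ne_top m Q), sub_add_cancel]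

end SouzaAtoms

section Direct

variable {m : Measure I} [IsFiniteMeasure m] {P : ℕ → Finset (Set I)} {l₁ l₂ s p : ℝ} {q : ℝ≥0∞}
  {f : I → ℂ} {c : Set I → ℂ} {a : Set I → I → ℂ}

theorem IsGoodGrid.eLpNorm_atomSum_le (hP : IsGoodGrid m P l₁ l₂) (hp : 0 < p) {k : ℕ}
    (ha : ∀ Q ∈ P k, a Q ∈ souzaAtoms m s p Q) :
    eLpNorm (atomSum (P k) c a) (ENNReal.ofReal p) (cellMeasure m s p (P k)) ≤
      coeffNorm p (P k) c :=
  BesovGrid.eLpNorm_atomSum_le hp (hP.pairwiseDisjoint k) (hP.measurableSet k)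
    (fun _ => hP.measure_ne_zero) ha

theorem IsGoodGrid.tsum_eLpNorm_atomSum_lt_top (hP : IsGoodGrid m P l₁ l₂) (hp : 0 < p)
    (hq : q ≠ 0) (hs : 0 < s) (ha : ∀ k, ∀ Q ∈ P k, a Q ∈ souzaAtoms m s p Q)
    (hc : cost P p q c < ∞) :
    ∑' k, eLpNorm (atomSum (P k) c a) (ENNReal.ofReal p) m < ∞ :=
  calc ∑' k, eLpNorm (atomSum (P k) c a) (ENNReal.ofReal p) m
      ≤ ∑' k, m Set.univ ^ s * ((ENNReal.ofReal l₂ ^ s) ^ k * cost P p q c) := by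
        gcongr with k
        refine (hP.eLpNorm_le_pow_mul_cellMeasure hp hs _ k).trans ?_
        gcongr
        exact (hP.eLpNorm_atomSum_le hp (ha k)).trans (coeffNorm_le_cost hq P p c k)
    _ = m Set.univ ^ s * ((1 - ENNReal.ofReal l₂ ^ s)⁻¹ * cost P p q c) := by
        rw [ENNReal.tsum_mul_left, ENNReal.tsum_mul_right, ENNReal.tsum_geometric]
    _ < ∞ := by
        refine ENNReal.mul_lt_top (ENNReal.rpow_lt_top_of_nonneg hs.le (measure_ne_top m _))
          (ENNReal.mul_lt_top ?_ hc)
        exact hP.inv_one_sub_rpow_lt_top hs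

theorem IsRepresentation.tendsto_eLpNorm_sub_sum (h : IsRepresentation m P s p q f c a)
    (hP : IsGoodGrid m P l₁ l₂) (hp : 0 < p) (hs : 0 < s) (k : ℕ) :
    Tendsto (fun n => eLpNorm (f - ∑ i ∈ Finset.range n, atomSum (P i) c a) (ENNReal.ofReal p)
      (cellMeasure m s p (P k))) atTop (𝓝 0) := by
  have hlim : Tendsto (fun n => eLpNorm (f - ∑ i ∈ Finset.range n, atomSum (P i) c a)
      (ENNReal.ofReal p) m) atTop (𝓝 0) := by
    convert h.tendsto using 3 with n
    ext x
    simp [atomSum]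
  have hl₁ : (ENNReal.ofReal l₁ ^ (-s)) ^ k ≠ ∞ := ENNReal.pow_ne_top
    (ENNReal.rpow_ne_top_of_ne_zero (by simpa using hP.pos) ENNReal.ofReal_ne_top)
  have hI : m Set.univ ^ (-s) ≠ ∞ :=
    ENNReal.rpow_ne_top_of_ne_zero (hP.measure_ne_zero hP.univ_mem) (measure_ne_top m _)
  refine tendsto_of_tendsto_of_tendsto_of_le_of_le tendsto_const_nhds ?_ (fun _ => zero_le)
    fun n => hP.eLpNorm_cellMeasure_le hp hs _ k
  simpa using ENNReal.Tendsto.const_mul (ENNReal.Tendsto.const_mul hlim (Or.inr hI)) (Or.inr hl₁)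

theorem IsRepresentation.eLpNorm_sub_sum_le (h : IsRepresentation m P s p q f c a)
    (hP : IsGoodGrid m P l₁ l₂) (hp : 1 ≤ p) (hs : 0 < s) (hf : AEStronglyMeasurable f m) (k : ℕ) :
    eLpNorm (f - ∑ i ∈ Finset.range k, atomSum (P i) c a) (ENNReal.ofReal p)
        (cellMeasure m s p (P k)) ≤
      ∑' j, (ENNReal.ofReal l₂ ^ s) ^ j * coeffNorm p (P (k + j)) c := by
  have hp₀ : 0 < p := by positivity
  have hmeas : ∀ i, Measurable (atomSum (P i) c a) := fun i =>
    measurable_atomSum (hP.measurableSet i) (h.atom i)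
  have htail : ∀ n, f - ∑ i ∈ Finset.range k, atomSum (P i) c a -
      ∑ j ∈ Finset.range n, atomSum (P (k + j)) c a =
        f - ∑ i ∈ Finset.range (k + n), atomSum (P i) c a := fun n => by
    rw [Finset.sum_range_add, sub_sub]
  refine (eLpNorm_le_tsum_of_tendsto (u := fun j => atomSum (P (k + j)) c a)
    (ENNReal.one_le_ofReal.2 hp) ?_ (fun j => (hmeas _).aestronglyMeasurable) ?_).trans ?_
  · exact (hf.mono_ac cellMeasure_absolutelyContinuous).sub
      (Finset.aestronglyMeasurable_sum _ fun i _ => (hmeas i).aestronglyMeasurable)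
  · simp_rw [htail, add_comm k]
    exact (h.tendsto_eLpNorm_sub_sum hP hp₀ hs k).comp (tendsto_add_atTop_nat k)
  · gcongr with j
    refine (hP.eLpNorm_cellMeasure_le_pow_mul hp₀ hs _ k j).trans ?_
    gcongr
    exact hP.eLpNorm_atomSum_le hp₀ (h.atom _)

theorem IsRepresentation.rpow_mul_eLpNorm_le (h : IsRepresentation m P s p q f c a)
    (hP : IsGoodGrid m P l₁ l₂) (hp : 1 ≤ p) (hq : q ≠ 0) (hs : 0 < s)
    (hf : AEStronglyMeasurable f m) :
    m Set.univ ^ (-s) * eLpNorm f (ENNReal.ofReal p) m ≤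
      (1 - ENNReal.ofReal l₂ ^ s)⁻¹ * cost P p q c := by
  have htail := h.eLpNorm_sub_sum_le hP hp hs hf 0
  rw [Finset.sum_range_zero, sub_zero, hP.eLpNorm_cellMeasure_zero (by positivity)] at htail
  refine htail.trans ?_
  rw [← ENNReal.tsum_geometric, ← ENNReal.tsum_mul_right]
  gcongr with j
  exact coeffNorm_le_cost hq P p c _

theorem IsRepresentation.oscNorm_le (h : IsRepresentation m P s p q f c a)
    (hP : IsGoodGrid m P l₁ l₂) (hp : 1 ≤ p) (hq : 1 ≤ q) (hs : 0 < s)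
    (hf : AEStronglyMeasurable f m) :
    oscNorm m P s p q f ≤ (1 - ENNReal.ofReal l₂ ^ s)⁻¹ * cost P p q c := by
  have hlevel : ∀ k, cellNorm m s p (P k) (osc m p f) ≤
      ∑' j, (ENNReal.ofReal l₂ ^ s) ^ j * coeffNorm p (P (k + j)) c := fun k => by
    refine le_trans ?_ (h.eLpNorm_sub_sum_le hP hp hs hf k)
    refine cellNorm_osc_le_eLpNorm_sub (by positivity) (hP.measurableSet k) f ?_
    exact CellwiseConst.sum fun i hi => hP.cellwiseConst_of_le (Finset.mem_range_le hi)
      (cellwiseConst_atomSum (hP.pairwiseDisjoint i) (h.atom i))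
  exact (lqNorm_mono hlevel).trans (lqNorm_tsum_pow_mul_le hq _ fun k => coeffNorm p (P k) c)

end Direct

section Greedy

variable {m : Measure I} {P : ℕ → Finset (Set I)} {F : Finset (Set I)} {l₁ l₂ s p : ℝ}
  {q : ℝ≥0∞}

section Residual

variable [NormedSpace ℝ E] {f : I → E}

/-- The function equal to the mean of `f` on each cell of the level `F`, and to `0` off `F`. -/
noncomputable def cellAverage (m : Measure I) (F : Finset (Set I)) (f : I → E) : I → E :=
  fun x => ∑ Q ∈ F, Q.indicator (fun _ => ⨍ y in Q, f y ∂m) x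

/-- What is left of `f` once the cell means have been subtracted on the levels below `k`, one level
after the other. -/
noncomputable def residual (m : Measure I) (P : ℕ → Finset (Set I)) (f : I → E) : ℕ → I → E
  | 0 => f
  | k + 1 => residual m P f k - cellAverage m (P k) (residual m P f k)

theorem eqOn_cellAverage (hF : (F : Set (Set I)).PairwiseDisjoint id) {Q : Set I} (hQ : Q ∈ F) :
    Set.EqOn (cellAverage m F f) (fun _ => ⨍ y in Q, f y ∂m) Q := by
  intro x hx
  refine (Finset.sum_eq_single_of_mem Q hQ fun R hR hne => ?_).trans (Set.indicator_of_mem hx _)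
  exact Set.indicator_of_notMem (Set.disjoint_left.1 (hF hQ hR hne.symm) hx) _

theorem memLp_cellAverage [IsFiniteMeasure m] (hF : ∀ Q ∈ F, MeasurableSet Q) (r : ℝ≥0∞) :
    MemLp (cellAverage m F f) r m :=
  memLp_finsetSum F fun Q hQ =>
    memLp_indicator_const r (hF Q hQ) _ (Or.inr (measure_ne_top m Q))

theorem residual_eq_sub_sum (k : ℕ) :
    residual m P f k = f - ∑ i ∈ Finset.range k, cellAverage m (P i) (residual m P f i) := by
  induction k with
  | zero => simp [residual]
  | succ k ih => rw [residual, Finset.sum_range_succ, ← sub_sub, ← ih]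

theorem IsGrid.memLp_residual [IsFiniteMeasure m] (hP : IsGrid m P) {r : ℝ≥0∞} (hf : MemLp f r m) :
    ∀ k, MemLp (residual m P f k) r m
  | 0 => hf
  | k + 1 => (hP.memLp_residual hf k).sub (memLp_cellAverage (hP.measurableSet k) r)

end Residual

variable {f : I → ℂ}

theorem IsGoodGrid.osc_residual (hP : IsGoodGrid m P l₁ l₂) (p : ℝ) (f : I → ℂ) {k : ℕ} {Q : Set I}
    (hQ : Q ∈ P k) : osc m p (residual m P f k) Q = osc m p f Q := by
  have hconst : CellwiseConst (P k)
      (∑ i ∈ Finset.range k, cellAverage m (P i) (residual m P f i)) :=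
    CellwiseConst.sum fun i hi => hP.cellwiseConst_of_le (Finset.mem_range_le hi)
      fun R hR => ⟨_, eqOn_cellAverage (hP.pairwiseDisjoint i) hR⟩
  obtain ⟨b, hb⟩ := hconst Q hQ
  rw [residual_eq_sub_sum, osc_sub_of_eqOn (hP.measurableSet k Q hQ) hb]

/-- The largest Souza atom on `Q`. -/
noncomputable def souzaAtom (m : Measure I) (s p : ℝ) (Q : Set I) : I → ℂ :=
  Q.indicator fun _ => ((m.real Q ^ (s - 1 / p) : ℝ) : ℂ)

/-- The coefficient of `souzaAtom` that represents the mean of `f` on `Q`. -/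
noncomputable def souzaCoeff (m : Measure I) (s p : ℝ) (f : I → ℂ) (Q : Set I) : ℂ :=
  (⨍ x in Q, f x ∂m) * ((m.real Q ^ (1 / p - s) : ℝ) : ℂ)

theorem souzaAtom_mem (m : Measure I) (s p : ℝ) (Q : Set I) :
    souzaAtom m s p Q ∈ souzaAtoms m s p Q := by
  refine ⟨fun x hx => Set.indicator_of_notMem hx _, fun x hx y hy => ?_, fun x => ?_⟩
  · rw [souzaAtom, Set.indicator_of_mem hx, Set.indicator_of_mem hy]
  · refine (norm_indicator_le_norm_self _ x).trans_eq ?_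
    rw [Complex.norm_real, Real.norm_of_nonneg (by positivity)]

theorem souzaCoeff_mul_souzaAtom {Q : Set I} (hQ : 0 < m.real Q) (f : I → ℂ) (x : I) :
    souzaCoeff m s p f Q * souzaAtom m s p Q x = Q.indicator (fun _ => ⨍ y in Q, f y ∂m) x := by
  by_cases hx : x ∈ Q
  · rw [souzaCoeff, souzaAtom, Set.indicator_of_mem hx, Set.indicator_of_mem hx, mul_assoc,
      ← Complex.ofReal_mul, ← Real.rpow_add hQ]
    simp
  · simp [souzaAtom, hx]

variable [IsFiniteMeasure m]

theorem eLpNorm_sub_setAverage_le_osc (hp : 1 ≤ p) {Q : Set I}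
    (hf : MemLp f (ENNReal.ofReal p) (m.restrict Q)) :
    eLpNorm (fun x => f x - ⨍ y in Q, f y ∂m) (ENNReal.ofReal p) (m.restrict Q) ≤
      2 * osc m p f Q := by
  rw [osc_eq_iInf_eLpNorm (by positivity),
    ENNReal.mul_iInf_of_ne two_ne_zero ENNReal.ofNat_ne_top]
  exact le_iInf (eLpNorm_sub_average_le (ENNReal.one_le_ofReal.2 hp) hf)

theorem IsGoodGrid.eLpNorm_residual_succ_le (hP : IsGoodGrid m P l₁ l₂) (hp : 1 ≤ p)
    (hf : MemLp f (ENNReal.ofReal p) m) (k : ℕ) :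
    eLpNorm (residual m P f (k + 1)) (ENNReal.ofReal p) (cellMeasure m s p (P k)) ≤
      2 * cellNorm m s p (P k) (osc m p f) := by
  have hp₀ : 0 < p := by positivity
  rw [eLpNorm_cellMeasure hp₀, ← cellNorm_const_mul hp₀]
  refine cellNorm_mono hp₀ fun Q hQ => ?_
  have hmean : residual m P f (k + 1) =ᵐ[m.restrict Q]
      fun x => residual m P f k x - ⨍ y in Q, residual m P f k y ∂m := by
    filter_upwards [ae_restrict_mem (hP.measurableSet k Q hQ)] with x hx
    rw [residual, Pi.sub_apply, eqOn_cellAverage (hP.pairwiseDisjoint k) hQ hx]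
  rw [eLpNorm_congr_ae hmean, ← hP.osc_residual p f hQ]
  exact eLpNorm_sub_setAverage_le_osc hp ((hP.memLp_residual hf k).restrict Q)

theorem IsGoodGrid.tendsto_eLpNorm_residual (hP : IsGoodGrid m P l₁ l₂) (hp : 1 ≤ p) (hq : q ≠ 0)
    (hs : 0 < s) (hf : MemLp f (ENNReal.ofReal p) m) (hosc : oscNorm m P s p q f < ∞) :
    Tendsto (fun k => eLpNorm (residual m P f k) (ENNReal.ofReal p) m) atTop (𝓝 0) := by
  have hdecay : ∀ k, eLpNorm (residual m P f (k + 1)) (ENNReal.ofReal p) m ≤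
      m Set.univ ^ s * ((ENNReal.ofReal l₂ ^ s) ^ k * (2 * oscNorm m P s p q f)) := fun k => by
    refine (hP.eLpNorm_le_pow_mul_cellMeasure (by positivity) hs _ k).trans ?_
    gcongr
    refine (hP.eLpNorm_residual_succ_le hp hf k).trans ?_
    gcongr
    exact le_lqNorm hq (fun k => cellNorm m s p (P k) (osc m p f)) k
  have hI : m Set.univ ^ s ≠ ∞ := ENNReal.rpow_ne_top_of_nonneg hs.le (measure_ne_top m _)
  rw [← tendsto_add_atTop_iff_nat 1]
  refine tendsto_of_tendsto_of_tendsto_of_le_of_le tendsto_const_nhds ?_ (fun _ => zero_le) hdecay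
  simpa using ENNReal.Tendsto.const_mul (ENNReal.Tendsto.mul_const
    (ENNReal.tendsto_pow_atTop_nhds_zero_of_lt_one (hP.rpow_lt_one hs))
    (Or.inr (ENNReal.mul_ne_top ENNReal.ofNat_ne_top hosc.ne))) (Or.inr hI)

theorem enorm_souzaCoeff_mul_rpow {Q : Set I} (hQ : m Q ≠ 0) (hp : 0 < p) (f : I → ℂ) :
    ‖souzaCoeff m s p f Q‖ₑ * m Q ^ s =
      eLpNorm (fun _ => ⨍ x in Q, f x ∂m) (ENNReal.ofReal p) (m.restrict Q) := by
  have hQ' : 0 < m.real Q := ENNReal.toReal_pos hQ (measure_ne_top m Q)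
  have hscale : ‖((m.real Q ^ (1 / p - s) : ℝ) : ℂ)‖ₑ = m Q ^ (1 / p - s) := by
    rw [← ofReal_norm, Complex.norm_real, Real.norm_of_nonneg (by positivity),
      ← ENNReal.ofReal_rpow_of_pos hQ', ofReal_measureReal (measure_ne_top m Q)]
  rw [souzaCoeff, enorm_mul, hscale, mul_assoc,
    ← ENNReal.rpow_add _ _ hQ (measure_ne_top m Q), sub_add_cancel,
    eLpNorm_const' _ (by simpa using hp) ENNReal.ofReal_ne_top, ENNReal.toReal_ofReal hp.le,
    Measure.restrict_apply_univ]

theorem coeffNorm_souzaCoeff_le (hp : 1 ≤ p) (h₀ : ∀ Q ∈ F, m Q ≠ 0)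
    (hf : AEStronglyMeasurable f m) :
    coeffNorm p F (souzaCoeff m s p f) ≤ eLpNorm f (ENNReal.ofReal p) (cellMeasure m s p F) := by
  have hp₀ : 0 < p := by positivity
  rw [coeffNorm_eq_cellNorm hp₀ h₀, eLpNorm_cellMeasure hp₀]
  refine cellNorm_mono hp₀ fun Q hQ => ?_
  rw [enorm_souzaCoeff_mul_rpow (h₀ Q hQ) hp₀]
  exact eLpNorm_const_average_le (ENNReal.one_le_ofReal.2 hp) hf.restrict

theorem IsGoodGrid.lqNorm_coeffNorm_residual_le (hP : IsGoodGrid m P l₁ l₂) (hp : 1 ≤ p)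
    (hq : 1 ≤ q) (hs : 0 < s) (hf : MemLp f (ENNReal.ofReal p) m) :
    lqNorm q (fun k => coeffNorm p (P k) (souzaCoeff m s p (residual m P f k))) ≤
      m Set.univ ^ (-s) * eLpNorm f (ENNReal.ofReal p) m +
        2 * ENNReal.ofReal l₁ ^ (-s) * oscNorm m P s p q f := by
  have hp₀ : 0 < p := by positivity
  have hcoeff : ∀ k, coeffNorm p (P k) (souzaCoeff m s p (residual m P f k)) ≤
      eLpNorm (residual m P f k) (ENNReal.ofReal p) (cellMeasure m s p (P k)) := fun k =>
    coeffNorm_souzaCoeff_le hp (fun _ => hP.measure_ne_zero) (hP.memLp_residual hf k).1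
  refine (lqNorm_le_zero_add_succ hq _).trans (add_le_add ?_ ?_)
  · exact (hcoeff 0).trans_eq (hP.eLpNorm_cellMeasure_zero hp₀ f)
  · rw [oscNorm_eq_lqNorm_cellNorm, ← lqNorm_const_mul (one_pos.trans_le hq).ne']
    refine lqNorm_mono fun k => ?_
    calc coeffNorm p (P (k + 1)) (souzaCoeff m s p (residual m P f (k + 1)))
        ≤ eLpNorm (residual m P f (k + 1)) (ENNReal.ofReal p) (cellMeasure m s p (P (k + 1))) :=
          hcoeff (k + 1)
      _ ≤ ENNReal.ofReal l₁ ^ (-s) *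
            eLpNorm (residual m P f (k + 1)) (ENNReal.ofReal p) (cellMeasure m s p (P k)) :=
          hP.eLpNorm_cellMeasure_succ_le hp₀ hs _ k
      _ ≤ ENNReal.ofReal l₁ ^ (-s) * (2 * cellNorm m s p (P k) (osc m p f)) := by
          gcongr
          exact hP.eLpNorm_residual_succ_le hp hf k
      _ = 2 * ENNReal.ofReal l₁ ^ (-s) * cellNorm m s p (P k) (osc m p f) := by ring

theorem IsGoodGrid.exists_isRepresentation (hP : IsGoodGrid m P l₁ l₂) (hp : 1 ≤ p)
    (hq : 1 ≤ q) (hs : 0 < s) (hf : MemLp f (ENNReal.ofReal p) m)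
    (hosc : oscNorm m P s p q f < ∞) :
    ∃ c a, IsRepresentation m P s p q f c a ∧
      cost P p q c ≤ m Set.univ ^ (-s) * eLpNorm f (ENNReal.ofReal p) m +
        2 * ENNReal.ofReal l₁ ^ (-s) * oscNorm m P s p q f := by
  have hp₀ : 0 < p := by positivity
  have hq₀ : q ≠ 0 := (one_pos.trans_le hq).ne'
  obtain ⟨c, hc⟩ := hP.exists_forall_level_eq fun k => souzaCoeff m s p (residual m P f k)
  have hatom : ∀ k, ∀ Q ∈ P k, souzaAtom m s p Q ∈ souzaAtoms m s p Q :=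
    fun _ Q _ => souzaAtom_mem m s p Q
  have hlevel : ∀ k, atomSum (P k) c (souzaAtom m s p) =
      cellAverage m (P k) (residual m P f k) := fun k => by
    ext x
    refine Finset.sum_congr rfl fun Q hQ => ?_
    rw [hc k Q hQ, souzaCoeff_mul_souzaAtom (hP.measureReal_pos hQ)]
  have hcost : cost P p q c ≤ m Set.univ ^ (-s) * eLpNorm f (ENNReal.ofReal p) m +
      2 * ENNReal.ofReal l₁ ^ (-s) * oscNorm m P s p q f := by
    refine le_trans (lqNorm_mono fun k => le_of_eq ?_)
      (hP.lqNorm_coeffNorm_residual_le hp hq hs hf)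
    exact congr_arg (· ^ (1 / p)) (Finset.sum_congr rfl fun Q hQ => by rw [hc k Q hQ])
  have hcost_lt : cost P p q c < ∞ := by
    refine hcost.trans_lt (ENNReal.add_lt_top.2 ⟨ENNReal.mul_lt_top ?_ hf.2,
      ENNReal.mul_lt_top (ENNReal.mul_lt_top ENNReal.ofNat_lt_top ?_) hosc⟩)
    · exact (ENNReal.rpow_ne_top_of_ne_zero (hP.measure_ne_zero hP.univ_mem)
        (measure_ne_top m _)).lt_top
    · exact (ENNReal.rpow_ne_top_of_ne_zero (by simpa using hP.pos)
        ENNReal.ofReal_ne_top).lt_top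
  refine ⟨c, souzaAtom m s p, ⟨hatom, ?_, ?_, hcost_lt⟩, hcost⟩
  · exact hP.tsum_eLpNorm_atomSum_lt_top hp₀ hq₀ hs hatom hcost_lt
  · convert hP.tendsto_eLpNorm_residual hp hq₀ hs hf hosc using 3 with n
    rw [residual_eq_sub_sum]
    ext x
    simp [← hlevel, atomSum]

end Greedy

section NormEquivalence

variable {m : Measure I} {P : ℕ → Finset (Set I)} {l₁ l₂ s p : ℝ} {q : ℝ≥0∞}
  {f : I → ℂ}

theorem le_mul_besovNorm {C x : ℝ≥0∞} (hC₀ : C ≠ 0) (hC : C ≠ ∞)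
    (h : ∀ c a, IsRepresentation m P s p q f c a → x ≤ C * cost P p q c) :
    x ≤ C * besovNorm m P s p q f := by
  rw [mul_comm, ← ENNReal.div_le_iff hC₀ hC]
  refine le_sInf ?_
  rintro _ ⟨c, a, hca, rfl⟩
  rw [ENNReal.div_le_iff hC₀ hC, mul_comm]
  exact h c a hca

variable [IsFiniteMeasure m]

theorem IsGoodGrid.memBesov_iff (hP : IsGoodGrid m P l₁ l₂) (hp : 1 ≤ p) (hq : 1 ≤ q)
    (hs : 0 < s) :
    MemBesov m P s p q f ↔ MemLp f (ENNReal.ofReal p) m ∧ oscNorm m P s p q f < ∞ := by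
  refine and_congr_right fun hf => ⟨?_, fun hosc => ?_⟩
  · rintro ⟨c, a, h⟩
    exact (h.oscNorm_le hP hp hq hs hf.1).trans_lt
      (ENNReal.mul_lt_top (hP.inv_one_sub_rpow_lt_top hs) h.cost_lt_top)
  · obtain ⟨c, a, h, -⟩ := hP.exists_isRepresentation hp hq hs hf hosc
    exact ⟨c, a, h⟩

theorem IsGoodGrid.rpow_mul_eLpNorm_le_besovNorm (hP : IsGoodGrid m P l₁ l₂) (hp : 1 ≤ p)
    (hq : q ≠ 0) (hs : 0 < s) (hf : AEStronglyMeasurable f m) :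
    m Set.univ ^ (-s) * eLpNorm f (ENNReal.ofReal p) m ≤
      (1 - ENNReal.ofReal l₂ ^ s)⁻¹ * besovNorm m P s p q f :=
  le_mul_besovNorm (by simp) (hP.inv_one_sub_rpow_lt_top hs).ne
    fun _ _ h => h.rpow_mul_eLpNorm_le hP hp hq hs hf

theorem IsGoodGrid.oscNorm_le_besovNorm (hP : IsGoodGrid m P l₁ l₂) (hp : 1 ≤ p) (hq : 1 ≤ q)
    (hs : 0 < s) (hf : AEStronglyMeasurable f m) :
    oscNorm m P s p q f ≤ (1 - ENNReal.ofReal l₂ ^ s)⁻¹ * besovNorm m P s p q f :=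
  le_mul_besovNorm (by simp) (hP.inv_one_sub_rpow_lt_top hs).ne
    fun _ _ h => h.oscNorm_le hP hp hq hs hf

theorem IsGoodGrid.besovNorm_le (hP : IsGoodGrid m P l₁ l₂) (hp : 1 ≤ p) (hq : 1 ≤ q)
    (hs : 0 < s) (hf : MemBesov m P s p q f) :
    besovNorm m P s p q f ≤ m Set.univ ^ (-s) * eLpNorm f (ENNReal.ofReal p) m +
      2 * ENNReal.ofReal l₁ ^ (-s) * oscNorm m P s p q f := by
  obtain ⟨hLp, hosc⟩ := (hP.memBesov_iff hp hq hs).1 hf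
  obtain ⟨c, a, h, hcost⟩ := hP.exists_isRepresentation hp hq hs hLp hosc
  refine le_trans (sInf_le ?_) hcost
  exact ⟨c, a, h, rfl⟩

variable {g : ℂ → ℂ} {K : ℝ≥0}

theorem IsGoodGrid.memBesov_comp (hP : IsGoodGrid m P l₁ l₂) (hp : 1 ≤ p) (hq : 1 ≤ q)
    (hs : 0 < s) (hg : LipschitzWith K g) (hg0 : g 0 = 0) (hf : MemBesov m P s p q f) :
    MemBesov m P s p q (g ∘ f) := by
  rw [hP.memBesov_iff hp hq hs] at hf ⊢
  exact ⟨hg.comp_memLp hg0 hf.1,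
    (oscNorm_comp_le (by positivity) (one_pos.trans_le hq).ne' hg f).trans_lt
      (ENNReal.mul_lt_top ENNReal.coe_lt_top hf.2)⟩

theorem IsGoodGrid.besovNorm_comp_le (hP : IsGoodGrid m P l₁ l₂) (hp : 1 ≤ p) (hq : 1 ≤ q)
    (hs : 0 < s) (hg : LipschitzWith K g) (hg0 : g 0 = 0) (hf : MemBesov m P s p q f) :
    besovNorm m P s p q (g ∘ f) ≤
      K * (1 + 2 * ENNReal.ofReal l₁ ^ (-s)) * (1 - ENNReal.ofReal l₂ ^ s)⁻¹ *
        besovNorm m P s p q f := by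
  have hq₀ : q ≠ 0 := (one_pos.trans_le hq).ne'
  set A := ENNReal.ofReal l₁ ^ (-s)
  set B := (1 - ENNReal.ofReal l₂ ^ s)⁻¹
  calc besovNorm m P s p q (g ∘ f)
      ≤ m Set.univ ^ (-s) * eLpNorm (g ∘ f) (ENNReal.ofReal p) m +
          2 * A * oscNorm m P s p q (g ∘ f) :=
        hP.besovNorm_le hp hq hs (hP.memBesov_comp hp hq hs hg hg0 hf)
    _ ≤ m Set.univ ^ (-s) * (K * eLpNorm f (ENNReal.ofReal p) m) +
          2 * A * (K * oscNorm m P s p q f) := by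
        gcongr
        · exact eLpNorm_comp_le hg hg0 _ f
        · exact oscNorm_comp_le (by positivity) hq₀ hg f
    _ = K * (m Set.univ ^ (-s) * eLpNorm f (ENNReal.ofReal p) m) +
          K * (2 * A) * oscNorm m P s p q f := by ring
    _ ≤ K * (B * besovNorm m P s p q f) + K * (2 * A) * (B * besovNorm m P s p q f) := by
        gcongr K * ?_ + K * (2 * A) * ?_
        · exact hP.rpow_mul_eLpNorm_le_besovNorm hp hq₀ hs hf.1.1
        · exact hP.oscNorm_le_besovNorm hp hq hs hf.1.1
    _ = K * (1 + 2 * A) * B * besovNorm m P s p q f := by ring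

theorem IsGoodGrid.exists_besovNorm_comp_le (hP : IsGoodGrid m P l₁ l₂) (hp : 1 ≤ p)
    (hq : 1 ≤ q) (hs : 0 < s) (hg : LipschitzWith K g) (hg0 : g 0 = 0) :
    ∃ C : ℝ≥0, ∀ f : I → ℂ, MemBesov m P s p q f →
      besovNorm m P s p q (g ∘ f) ≤ C * besovNorm m P s p q f := by
  have hl₁ : ENNReal.ofReal l₁ ^ (-s) ≠ ∞ :=
    ENNReal.rpow_ne_top_of_ne_zero (by simpa using hP.pos) ENNReal.ofReal_ne_top
  have hC : (K : ℝ≥0∞) * (1 + 2 * ENNReal.ofReal l₁ ^ (-s)) * (1 - ENNReal.ofReal l₂ ^ s)⁻¹ ≠ ∞ :=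
    ENNReal.mul_ne_top (ENNReal.mul_ne_top ENNReal.coe_ne_top (ENNReal.add_ne_top.2
      ⟨ENNReal.one_ne_top, ENNReal.mul_ne_top ENNReal.ofNat_ne_top hl₁⟩))
      (hP.inv_one_sub_rpow_lt_top hs).ne
  refine ⟨(K * (1 + 2 * ENNReal.ofReal l₁ ^ (-s)) * (1 - ENNReal.ofReal l₂ ^ s)⁻¹).toNNReal,
    fun f hf => ?_⟩
  rw [ENNReal.coe_toNNReal hC]
  exact hP.besovNorm_comp_le hp hq hs hg hg0 hf

end NormEquivalence

end BesovGrid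

theorem proposition19p1_general {I : Type*} [MeasurableSpace I] (m : Measure I)
    [IsFiniteMeasure m] (P : ℕ → Finset (Set I)) (l₁ l₂ : ℝ) (hP : BesovGrid.IsGoodGrid m P l₁ l₂)
    (s p : ℝ) (q : ℝ≥0∞) (hp : 1 ≤ p) (hq : 1 ≤ q) (hs : 0 < s)
    (g : ℂ → ℂ) (K : ℝ≥0) (hg : LipschitzWith K g) (hg0 : g 0 = 0) :
    (∀ f f' : I → ℂ, f =ᵐ[m] f' → g ∘ f =ᵐ[m] g ∘ f') ∧
    (∀ f : I → ℂ, BesovGrid.MemBesov m P s p q f → BesovGrid.MemBesov m P s p q (g ∘ f)) ∧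
    (∀ f : I → ℂ,
      eLpNorm (g ∘ f) (ENNReal.ofReal p) m + BesovGrid.oscNorm m P s p q (g ∘ f) ≤
        K * (eLpNorm f (ENNReal.ofReal p) m + BesovGrid.oscNorm m P s p q f)) ∧
    ∃ C : ℝ≥0, ∀ f : I → ℂ, BesovGrid.MemBesov m P s p q f →
      BesovGrid.besovNorm m P s p q (g ∘ f) ≤ C * BesovGrid.besovNorm m P s p q f := by
  refine ⟨fun f f' h => h.fun_comp g, fun f hf => hP.memBesov_comp hp hq hs hg hg0 hf,
    fun f => ?_, hP.exists_besovNorm_comp_le hp hq hs hg hg0⟩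
  rw [mul_add]
  exact add_le_add (BesovGrid.eLpNorm_comp_le hg hg0 _ f)
    (BesovGrid.oscNorm_comp_le (by positivity) (one_pos.trans_le hq).ne' hg f)

theorem proposition19p1 {I : Type*} [MeasurableSpace I] (m : Measure I) [IsFiniteMeasure m]
    (P : ℕ → Finset (Set I)) (l₁ l₂ : ℝ) (hP : BesovGrid.IsGoodGrid m P l₁ l₂)
    (s p : ℝ) (q : ℝ≥0∞) (hp : 1 ≤ p) (hq : 1 ≤ q) (hs : 0 < s) (hsp : s < 1 / p)
    (g : ℂ → ℂ) (K : ℝ≥0) (hg : LipschitzWith K g) (hg0 : g 0 = 0) :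
    -- the map `f ↦ g ∘ f` is well defined on classes modulo null sets, and maps the space to itself
    (∀ f f' : I → ℂ, f =ᵐ[m] f' → g ∘ f =ᵐ[m] g ∘ f') ∧
    (∀ f : I → ℂ, BesovGrid.MemBesov m P s p q f → BesovGrid.MemBesov m P s p q (g ∘ f)) ∧
    (∀ f : I → ℂ, MemLp f (ENNReal.ofReal p) m →
      eLpNorm (g ∘ f) (ENNReal.ofReal p) m + BesovGrid.oscNorm m P s p q (g ∘ f) ≤
        K * (eLpNorm f (ENNReal.ofReal p) m + BesovGrid.oscNorm m P s p q f)) ∧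
    ∃ C : ℝ≥0, ∀ f : I → ℂ, BesovGrid.MemBesov m P s p q f →
      BesovGrid.besovNorm m P s p q (g ∘ f) ≤ C * BesovGrid.besovNorm m P s p q f := by
  have h := proposition19p1_general m P l₁ l₂ hP s p q hp hq hs g K hg hg0
  exact ⟨h.1, h.2.1, fun f _ => h.2.2.1 f, h.2.2.2⟩
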